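/- **Conventions.** A vertex operator algebra is a $\mathbb Z$-graded complex vector space $V=\bigoplus_{n\in\mathbb Z}V_{(n)}$, with $\dim V_{(n)}<\infty$ and $V_{(n)}=0$ for $n$ sufficiently small, together with a linear map $a\mapsto Y(a,x)=\sum_{n\in\mathbb Z}a_nx^{-n-1}\in(\operatorname{End}V)[[x,x^{-1}]]$ and vectors $\mathbf 1,\omega\in V$ such that: $Y(\mathbf 1,x)=1$; $Y(a,x)\mathbf 1\in V[[x]]$ has constant term $a$; $Y(a,x)b\in V((x))$; the Jacobi identity $$x_0^{-1}\delta\Big(\frac{x_1-x_2}{x_0}\Big)Y(a,x_1)Y(b,x_2)-x_0^{-1}\delta\Big(\frac{-x_2+x_1}{x_0}\Big)Y(b,x_2)Y(a,x_1)=x_2^{-1}\delta\Big(\frac{x_1-x_0}{x_2}\Big)Y(Y(a,x_0)b,x_2)$$ holds; the operators $L(n)$ defined by $Y(\omega,x)=\sum_nL(n)x^{-n-2}$ satisfy the Virasoro relations with some central charge; $Y(L(-1)a,x)=\frac{d}{dx}Y(a,x)$; and $L(0)$ acts as $n$ on $V_{(n)}$. A weak $V$-module is a complex vector space $M$ with a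 linear map $Y_M:V\to(\operatorname{End}M)[[x,x^{-1}]]$ such that $Y_M(\mathbf 1,x)=1$, $Y_M(L(-1)a,x)=\frac{d}{dx}Y_M(a,x)$, $Y_M(a,x)u\in M((x))$, and the analogous Jacobi identity holds. A $V$-module is a weak $V$-module $M=\bigoplus_{h\in\mathbb C}M_{(h)}$, where $L(0)$ acts as $h$ on $M_{(h)}$, $\dim M_{(h)}<\infty$, and for every $h$, $M_{(h+n)}=0$ for $n\in\mathbb Z$ sufficiently small. A submodule is a subspace stable under all $a_n$; irreducible means nonzero with no submodules other than $0$ and itself; completely reducible means a direct sum of irreducible submodules. An intertwining operator of type $\binom{M_3}{M_1\,M_2}$ is a linear map $u\mapsto I(u,x)=\sum_{\alpha\in\mathbb C}u_\alpha x^{-\alpha-1}$ from $M_1$ to $(\operatorname{Hom}(M_2,M_3))\{x\}$ such that, for fixed $u,w,\alpha$, $u_{\alpha+n}w=0$ for $n\in\mathbb Z$ sufficiently large, $I(L(-1)u,x)w=\frac{d}{dx}I(u,x)w$, and the Jacobi identity holds with $Y(b,x_2)$ and $Y(Y(a,x_0)b,x_2)$ replaced by $I(u,x_2)$ and $I(Y(a,x_0)u,x_2)$.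 The fusion rule is the dimension of the space of intertwining operators of the given type. For $V$-modules $W_1,W_2$, let $G(W_1,W_2)$ be the space of all $\Phi(x)=\sum_{\alpha\in\mathbb C}\Phi_\alpha x^{-\alpha-1}\in(\operatorname{Hom}(W_1,W_2))\{x\}$ such that: (G1) for any $\alpha\in\mathbb C$ and $w\in W_1$, $\Phi_{\alpha+n}w=0$ for $n\in\mathbb Z$ sufficiently large; (G2) $[L(-1),\Phi(x)]=\Phi'(x)$; (G3) for any $a\in V$ there is a positive integer $k$ with $(x_1-x_2)^kY_{W_2}(a,x_1)\Phi(x_2)=(x_1-x_2)^k\Phi(x_2)Y_{W_1}(a,x_1)$. On the space of all series satisfying (G1), let $a\in V$ and $m\in\mathbb Z$ act by $$a(m)\circ\Phi(x)=\operatorname{Res}_{x_1}\big((x_1-x)^mY_{W_2}(a,x_1)\Phi(x)-(-x+x_1)^m\Phi(x)Y_{W_1}(a,x_1)\big),$$ where powers of binomials are expanded in nonnegative powers of the second term. A $V$-module inside $G(W_1,W_2)$ is a subspace of $G(W_1,W_2)$ that is stable under all $a(m)\circ$ and is a $V$-module with $a_m$ acting as $a(m)\circ$. Let $\Delta(W_1,W_2)$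 be the sum of all $V$-modules inside $G(W_1,W_2)$. **Proposition 4.9.** Let $V$ be a vertex operator algebra such that (1) there are only finitely many irreducible $V$-modules up to equivalence; (2) every $V$-module is completely reducible; (3) every fusion rule for three $V$-modules is finite. Then for any $V$-modules $W_1$ and $W_2$, $\Delta(W_1,W_2)$ is itself a $V$-module inside $G(W_1,W_2)$; it contains every $V$-module inside $G(W_1,W_2)$, and it is the unique maximal $V$-module inside $G(W_1,W_2)$ (with respect to inclusion). -/

import Mathlib

universe u v

namespace VOA

/-- A linear map `a ↦ Y(a, x) = ∑ₙ aₙ x^(-n-1)` from `V` to `(End M)[[x, x⁻¹]]`;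
`Y a n` is the coefficient `aₙ`. -/
abbrev Modes (V M : Type*) [AddCommGroup V] [Module ℂ V] [AddCommGroup M] [Module ℂ M] :=
  V →ₗ[ℂ] (ℤ → Module.End ℂ M)

section Basic

variable {V M M₁ M₂ M₃ : Type*} [AddCommGroup V] [Module ℂ V] [AddCommGroup M] [Module ℂ M]
  [AddCommGroup M₁] [Module ℂ M₁] [AddCommGroup M₂] [Module ℂ M₂] [AddCommGroup M₃] [Module ℂ M₃]

/-- `Y(a, x) u ∈ M((x))` for all `a` and `u`. -/
def Truncated (Y : Modes V M) : Prop :=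
  ∀ (a : V) (u : M), ∃ N : ℤ, ∀ n : ℤ, N ≤ n → Y a n u = 0

/-- The Jacobi identity
`x₀⁻¹ δ((x₁-x₂)/x₀) Y₃(a,x₁) I(u,x₂) w - x₀⁻¹ δ((-x₂+x₁)/x₀) I(u,x₂) Y₂(a,x₁) w
  = x₂⁻¹ δ((x₁-x₀)/x₂) I(Y₁(a,x₀)u, x₂) w`,
written out as the equality of the coefficients of `x₀^(-l-1) x₁^(-m-1) x₂^(-α-1)` on both sides.
Powers of binomials are expanded in nonnegative integral powers of the second summand.  The
exponents of `I(u, x) = ∑ u_α x^(-α-1)` range over `S`, which is `ℤ` for vertex operators and `ℂ`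
for intertwining operators.  All sums have finitely many nonzero terms as soon as the
truncation conditions hold. -/
def Jacobi {S : Type*} [Ring S] (Y₁ : Modes V M₁) (Y₂ : Modes V M₂) (Y₃ : Modes V M₃)
    (I : M₁ →ₗ[ℂ] (S → (M₂ →ₗ[ℂ] M₃))) : Prop :=
  ∀ (a : V) (u : M₁) (w : M₂) (l m : ℤ) (α : S),
    (∑ᶠ i : ℕ, ((-1 : ℤ) ^ i * Ring.choose l i) • Y₃ a (m + l - i) (I u (α + (i : S)) w))
      - (∑ᶠ i : ℕ, (((l - (i : ℤ)).negOnePow : ℤ) * Ring.choose l i) •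
          I u (α + (l : S) - (i : S)) (Y₂ a (m + i) w))
      = ∑ᶠ i : ℕ, (Ring.choose m i) • I (Y₁ a (l + i) u) ((m : S) + α - (i : S)) w

end Basic

/-- The structure of a vertex operator algebra on the complex vector space `V`. -/
structure VertexOperatorAlgebra (V : Type u) [AddCommGroup V] [Module ℂ V] where
  /-- The vertex operators, `Y a n = aₙ`. -/
  Y : Modes V V
  /-- The vacuum vector. -/
  one : V
  /-- The conformal vector. -/
  ω : V
  /-- The rank (central charge). -/
  rank : ℂ
  /-- The homogeneous subspace of weight `n`. -/
  wt : ℤ → Submodule ℂ V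
  wt_isInternal : DirectSum.IsInternal wt
  wt_finiteDimensional : ∀ n, FiniteDimensional ℂ (wt n)
  wt_eq_bot : ∃ N : ℤ, ∀ n : ℤ, n ≤ N → wt n = ⊥
  /-- `Y(1, x) = id`. -/
  Y_one : ∀ n : ℤ, Y one n = if n = -1 then 1 else 0
  /-- `Y(a, x) 1` has no negative powers of `x`, and its constant term is `a`. -/
  creation : ∀ a : V, (∀ n : ℤ, 0 ≤ n → Y a n one = 0) ∧ Y a (-1) one = a
  truncated : Truncated Y
  jacobi : Jacobi Y Y Y Y
  /-- The Virasoro relations for `L(n) = ω_(n+1)`, i.e. `Y(ω, x) = ∑ L(n) x^(-n-2)`. -/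
  virasoro : ∀ m n : ℤ,
    Y ω (m + 1) * Y ω (n + 1) - Y ω (n + 1) * Y ω (m + 1)
      = ((m : ℂ) - n) • Y ω (m + n + 1)
        + (if m + n = 0 then ((m : ℂ) ^ 3 - m) / 12 * rank else 0) • (1 : Module.End ℂ V)
  /-- `Y(L(-1)a, x) = d/dx Y(a, x)`. -/
  derivative : ∀ (a : V) (n : ℤ), Y (Y ω 0 a) n = (-(n : ℂ)) • Y a (n - 1)
  /-- `L(0) u = n u` for `u` of weight `n`. -/
  L0_wt : ∀ (n : ℤ) (u : V), u ∈ wt n → Y ω 1 u = (n : ℂ) • u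

section Modules

variable {V : Type u} [AddCommGroup V] [Module ℂ V] {M : Type*} [AddCommGroup M] [Module ℂ M]

/-- `(M, Y)` is a weak `V`-module. -/
structure IsWeakModule (A : VertexOperatorAlgebra V) (Y : Modes V M) : Prop where
  Y_one : ∀ n : ℤ, Y A.one n = if n = -1 then 1 else 0
  derivative : ∀ (a : V) (n : ℤ), Y (A.Y A.ω 0 a) n = (-(n : ℂ)) • Y a (n - 1)
  truncated : Truncated Y
  jacobi : Jacobi A.Y Y Y Y

/-- The subspace `M_(h)`, the eigenspace of `L(0) = ω₁` with eigenvalue `h`.  (In a module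
graded as `M = ⨁ M_(h)` with `L(0) = h` on `M_(h)`, each `M_(h)` is the whole eigenspace.) -/
def weightSpace (A : VertexOperatorAlgebra V) (Y : Modes V M) (h : ℂ) : Submodule ℂ M :=
  Module.End.eigenspace (Y A.ω 1) h

/-- `(M, Y)` is a `V`-module: a weak `V`-module which is the direct sum of its subspaces `M_(h)`,
all of finite dimension, and such that `M_(h+n) = 0` for `n ∈ ℤ` sufficiently small. -/
structure IsModule (A : VertexOperatorAlgebra V) (Y : Modes V M) : Prop
    extends IsWeakModule A Y where
  independent : iSupIndep (weightSpace A Y)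
  iSup_eq_top : ⨆ h, weightSpace A Y h = ⊤
  finiteDimensional : ∀ h, FiniteDimensional ℂ (weightSpace A Y h)
  weight_eq_bot : ∀ h : ℂ, ∃ N : ℤ, ∀ n : ℤ, n ≤ N → weightSpace A Y (h + n) = ⊥

/-- `N` is closed under all operators `aₙ`. -/
def IsStable (Y : Modes V M) (N : Submodule ℂ M) : Prop :=
  ∀ (a : V) (n : ℤ), ∀ x ∈ N, Y a n x ∈ N

/-- The restriction of the operators `aₙ` to a stable subspace. -/
def restrict (Y : Modes V M) (N : Submodule ℂ M) (h : IsStable Y N) : Modes V N where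
  toFun a n := (Y a n).restrict (h a n)
  map_add' a b := by
    funext n
    ext x
    simp
  map_smul' c a := by
    funext n
    ext x
    simp

/-- `M` is nonzero and has no stable subspaces besides `0` and `M`. -/
def IsIrreducible (Y : Modes V M) : Prop :=
  Nontrivial M ∧ ∀ N : Submodule ℂ M, IsStable Y N → N = ⊥ ∨ N = ⊤

/-- `M` is the (internal) direct sum of a set of irreducible submodules. -/
def IsCompletelyReducible (Y : Modes V M) : Prop :=
  ∃ S : Set (Submodule ℂ M),
    (∀ N ∈ S, ∃ h : IsStable Y N, IsIrreducible (restrict Y N h)) ∧ sSupIndep S ∧ sSup S = ⊤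

/-- Equivalence (isomorphism) of modules. -/
def Equivalent {M' : Type*} [AddCommGroup M'] [Module ℂ M'] (Y : Modes V M) (Y' : Modes V M') :
    Prop :=
  ∃ f : M ≃ₗ[ℂ] M', ∀ (a : V) (n : ℤ) (x : M), f (Y a n x) = Y' a n (f x)

/-- A `V`-module. -/
structure VModule (A : VertexOperatorAlgebra V) where
  carrier : Type v
  [addCommGroup : AddCommGroup carrier]
  [module : Module ℂ carrier]
  Y : Modes V carrier
  isModule : IsModule A Y

attribute [instance] VModule.addCommGroup VModule.module

end Modules

section Finsum

variable {E : Type*} [AddCommGroup E]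

theorem finite_support_of_eventually_zero {f : ℕ → E} (h : ∃ N : ℤ, ∀ i : ℕ, N ≤ i → f i = 0) :
    f.support.Finite := by
  obtain ⟨N, hN⟩ := h
  refine (Set.finite_lt_nat N.toNat).subset fun i hi => ?_
  by_contra hlt
  simp only [Set.mem_ofPred_eq, not_lt] at hlt
  exact hi (hN i (by omega))

theorem finsum_add_of_eventually_zero {f g : ℕ → E} (hf : ∃ N : ℤ, ∀ i : ℕ, N ≤ i → f i = 0)
    (hg : ∃ N : ℤ, ∀ i : ℕ, N ≤ i → g i = 0) :
    ∑ᶠ i, (f i + g i) = ∑ᶠ i, f i + ∑ᶠ i, g i :=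
  finsum_add_distrib (finite_support_of_eventually_zero hf) (finite_support_of_eventually_zero hg)

end Finsum

section Intertwining

variable {V : Type u} [AddCommGroup V] [Module ℂ V] {M₁ M₂ M₃ : Type*}
  [AddCommGroup M₁] [Module ℂ M₁] [AddCommGroup M₂] [Module ℂ M₂] [AddCommGroup M₃] [Module ℂ M₃]

/-- `I(·, x) : M₁ → Hom(M₂, M₃){x}`, `u ↦ ∑_α u_α x^(-α-1)` (with `I u α = u_α`), is an
intertwining operator of type `(M₃ over M₁ M₂)`. -/
structure IsIntertwining (A : VertexOperatorAlgebra V) (Y₁ : Modes V M₁) (Y₂ : Modes V M₂)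
    (Y₃ : Modes V M₃) (I : M₁ →ₗ[ℂ] (ℂ → (M₂ →ₗ[ℂ] M₃))) : Prop where
  truncated : ∀ (u : M₁) (w : M₂) (α : ℂ), ∃ N : ℤ, ∀ n : ℤ, N ≤ n → I u (α + n) w = 0
  /-- `I(L(-1)u, x) w = d/dx I(u, x) w`. -/
  derivative : ∀ (u : M₁) (w : M₂) (α : ℂ), I (Y₁ A.ω 0 u) α w = (-α) • I u (α - 1) w
  jacobi : Jacobi Y₁ Y₂ Y₃ I

/-- The vector space of intertwining operators of type `(M₃ over M₁ M₂)`, for weak modules. Its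
dimension is the fusion rule. -/
def intertwiningOperators (A : VertexOperatorAlgebra V) (Y₁ : Modes V M₁) (Y₂ : Modes V M₂)
    (Y₃ : Modes V M₃) (h₁ : IsWeakModule A Y₁) (h₂ : IsWeakModule A Y₂)
    (_h₃ : IsWeakModule A Y₃) :
    Submodule ℂ (M₁ →ₗ[ℂ] (ℂ → (M₂ →ₗ[ℂ] M₃))) where
  carrier := {I | IsIntertwining A Y₁ Y₂ Y₃ I}
  zero_mem' := ⟨fun u w α => ⟨0, by simp⟩, by simp, fun a u w l m α => by simp⟩
  smul_mem' c I hI := by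
    refine ⟨fun u w α => ?_, fun u w α => ?_, fun a u w l m α => ?_⟩
    · obtain ⟨N, hN⟩ := hI.truncated u w α
      exact ⟨N, fun n hn => by simp [hN n hn]⟩
    · have := hI.derivative u w α
      simp only [LinearMap.smul_apply, Pi.smul_apply, this, smul_comm c]
    · have := congrArg (c • ·) (hI.jacobi a u w l m α)
      simp only [smul_sub, smul_finsum] at this
      simp only [LinearMap.smul_apply, Pi.smul_apply, map_smul]
      simpa only [smul_comm c] using this
  add_mem' := by
    intro I J hI hJ
    refine ⟨fun u w α => ?_, fun u w α => ?_, fun a u w l m α => ?_⟩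
    · obtain ⟨N, hN⟩ := hI.truncated u w α
      obtain ⟨N', hN'⟩ := hJ.truncated u w α
      refine ⟨max N N', fun n hn => ?_⟩
      simp [hN n (le_trans (le_max_left _ _) hn), hN' n (le_trans (le_max_right _ _) hn)]
    · simp [hI.derivative u w α, hJ.derivative u w α]
    · have key1 : ∀ K, IsIntertwining A Y₁ Y₂ Y₃ K → ∃ N : ℤ, ∀ i : ℕ, N ≤ i →
          ((-1 : ℤ) ^ i * Ring.choose l i) • Y₃ a (m + l - i) (K u (α + (i : ℂ)) w) = 0 := by
        intro K hK
        obtain ⟨N, hN⟩ := hK.truncated u w α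
        refine ⟨N, fun i hi => ?_⟩
        have := hN i hi
        rw [Int.cast_natCast] at this
        rw [this, map_zero, smul_zero]
      have key2 : ∀ K : M₁ →ₗ[ℂ] (ℂ → (M₂ →ₗ[ℂ] M₃)), ∃ N : ℤ, ∀ i : ℕ, N ≤ i →
          (((l - (i : ℤ)).negOnePow : ℤ) * Ring.choose l i) •
            K u (α + (l : ℂ) - (i : ℂ)) (Y₂ a (m + i) w) = 0 := by
        intro K
        obtain ⟨N, hN⟩ := h₂.truncated a w
        refine ⟨N - m, fun i hi => ?_⟩
        rw [hN (m + i) (by omega), map_zero, smul_zero]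
      have key3 : ∀ K : M₁ →ₗ[ℂ] (ℂ → (M₂ →ₗ[ℂ] M₃)), ∃ N : ℤ, ∀ i : ℕ, N ≤ i →
          (Ring.choose m i) • K (Y₁ a (l + i) u) ((m : ℂ) + α - (i : ℂ)) w = 0 := by
        intro K
        obtain ⟨N, hN⟩ := h₁.truncated a u
        refine ⟨N - l, fun i hi => ?_⟩
        rw [hN (l + i) (by omega)]
        simp
      simp only [LinearMap.add_apply, Pi.add_apply, map_add, smul_add]
      rw [finsum_add_of_eventually_zero (key1 I hI) (key1 J hJ),
        finsum_add_of_eventually_zero (key2 I) (key2 J),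
        finsum_add_of_eventually_zero (key3 I) (key3 J),
        ← hI.jacobi a u w l m α, ← hJ.jacobi a u w l m α]
      abel

end Intertwining

section Generalized

variable {V : Type u} [AddCommGroup V] [Module ℂ V] {M₁ M₂ : Type*}
  [AddCommGroup M₁] [Module ℂ M₁] [AddCommGroup M₂] [Module ℂ M₂]

/-- The space of all series `Φ(x) = ∑_α Φ_α x^(-α-1) ∈ Hom(M₁, M₂){x}` such that for all `α` and
`w`, `Φ_(α+n) w = 0` for `n ∈ ℤ` sufficiently large. -/
def truncatedSeries (M₁ M₂ : Type*) [AddCommGroup M₁] [Module ℂ M₁] [AddCommGroup M₂]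
    [Module ℂ M₂] : Submodule ℂ (ℂ → (M₁ →ₗ[ℂ] M₂)) where
  carrier := {Φ | ∀ (α : ℂ) (w : M₁), ∃ N : ℤ, ∀ n : ℤ, N ≤ n → Φ (α + n) w = 0}
  zero_mem' := fun α w => ⟨0, by simp⟩
  smul_mem' c Φ h := fun α w => by
    obtain ⟨N, hN⟩ := h α w
    exact ⟨N, fun n hn => by simp [hN n hn]⟩
  add_mem' := by
    intro Φ Ψ h h' α w
    obtain ⟨N, hN⟩ := h α w
    obtain ⟨N', hN'⟩ := h' α w
    refine ⟨max N N', fun n hn => ?_⟩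
    simp [hN n (le_trans (le_max_left _ _) hn), hN' n (le_trans (le_max_right _ _) hn)]

/-- Multiplication of a series `∑ f(m, α) x₁^(-m-1) x₂^(-α-1)` by `x₁ - x₂`. -/
def mulSub (E : Type*) [AddCommGroup E] [Module ℂ E] : Module.End ℂ (ℤ → ℂ → E) where
  toFun f m α := f (m + 1) α - f m (α + 1)
  map_add' f g := by
    funext m α
    simp only [Pi.add_apply]
    abel
  map_smul' c f := by
    funext m α
    simp [smul_sub]

/-- The coefficients of `Y_{M₂}(a, x₁) Φ(x₂)`. -/
def leftProduct (Y₂ : Modes V M₂) (a : V) (Φ : ℂ → (M₁ →ₗ[ℂ] M₂)) :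
    ℤ → ℂ → (M₁ →ₗ[ℂ] M₂) :=
  fun m α => Y₂ a m ∘ₗ Φ α

/-- The coefficients of `Φ(x₂) Y_{M₁}(a, x₁)`. -/
def rightProduct (Y₁ : Modes V M₁) (a : V) (Φ : ℂ → (M₁ →ₗ[ℂ] M₂)) :
    ℤ → ℂ → (M₁ →ₗ[ℂ] M₂) :=
  fun m α => Φ α ∘ₗ Y₁ a m

/-- The space `G(M₁, M₂)` of generalized intertwining operators from `M₁` to `M₂`:
the truncated series `Φ(x)` such that `[L(-1), Φ(x)] = Φ'(x)` and such that for each `a`,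
`(x₁-x₂)^k Y_{M₂}(a,x₁) Φ(x₂) = (x₁-x₂)^k Φ(x₂) Y_{M₁}(a,x₁)` for some positive integer `k`. -/
def generalizedIntertwining (A : VertexOperatorAlgebra V) (Y₁ : Modes V M₁) (Y₂ : Modes V M₂) :
    Submodule ℂ (truncatedSeries M₁ M₂) where
  carrier := {Φ |
    (∀ α : ℂ, Y₂ A.ω 0 ∘ₗ Φ.1 α - Φ.1 α ∘ₗ Y₁ A.ω 0 = (-α) • Φ.1 (α - 1)) ∧
    ∀ a : V, ∃ k : ℕ, 0 < k ∧
      (mulSub (M₁ →ₗ[ℂ] M₂) ^ k) (leftProduct Y₂ a Φ.1) =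
        (mulSub (M₁ →ₗ[ℂ] M₂) ^ k) (rightProduct Y₁ a Φ.1)}
  zero_mem' := by
    refine ⟨fun α => by simp, fun a => ⟨1, one_pos, ?_⟩⟩
    congr 1
    funext m α
    simp [leftProduct, rightProduct]
  smul_mem' c Φ h := by
    refine ⟨fun α => ?_, fun a => ?_⟩
    · have := congrArg (c • ·) (h.1 α)
      simpa [LinearMap.comp_smul, LinearMap.smul_comp, smul_sub, smul_comm c] using this
    · obtain ⟨k, hk, h2⟩ := h.2 a
      refine ⟨k, hk, ?_⟩
      have e1 : leftProduct Y₂ a (c • Φ).1 = c • leftProduct Y₂ a Φ.1 := by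
        funext m α
        simp [leftProduct, LinearMap.comp_smul]
      have e2 : rightProduct Y₁ a (c • Φ).1 = c • rightProduct Y₁ a Φ.1 := by
        funext m α
        simp [rightProduct, LinearMap.smul_comp]
      rw [e1, e2, map_smul, map_smul, h2]
  add_mem' := by
    intro Φ Ψ h h'
    refine ⟨fun α => ?_, fun a => ?_⟩
    · have e1 := h.1 α
      have e2 := h'.1 α
      simp only [Submodule.coe_add, Pi.add_apply, LinearMap.comp_add, LinearMap.add_comp, smul_add]
      rw [← e1, ← e2]
      abel
    · obtain ⟨k, hk, h2⟩ := h.2 a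
      obtain ⟨k', -, h2'⟩ := h'.2 a
      refine ⟨k + k', by omega, ?_⟩
      have e1 : leftProduct Y₂ a (Φ + Ψ).1 = leftProduct Y₂ a Φ.1 + leftProduct Y₂ a Ψ.1 := by
        funext m α
        simp [leftProduct, LinearMap.comp_add]
      have e2 : rightProduct Y₁ a (Φ + Ψ).1 = rightProduct Y₁ a Φ.1 + rightProduct Y₁ a Ψ.1 := by
        funext m α
        simp [rightProduct, LinearMap.add_comp]
      rw [e1, e2, map_add, map_add]
      congr 1
      · rw [add_comm, pow_add, Module.End.mul_apply, h2, ← Module.End.mul_apply]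
      · rw [pow_add, Module.End.mul_apply, h2', ← Module.End.mul_apply]

/-- The terms of the first sum in `circCoeff`. -/
def circLeft (Y₂ : Modes V M₂) (a : V) (m : ℤ) (Φ : ℂ → (M₁ →ₗ[ℂ] M₂)) (α : ℂ) (w : M₁)
    (i : ℕ) : M₂ :=
  ((-1 : ℤ) ^ i * Ring.choose m i) • Y₂ a (m - i) (Φ (α + (i : ℂ)) w)

/-- The terms of the second sum in `circCoeff`. -/
def circRight (Y₁ : Modes V M₁) (a : V) (m : ℤ) (Φ : ℂ → (M₁ →ₗ[ℂ] M₂)) (α : ℂ) (w : M₁)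
    (i : ℕ) : M₂ :=
  (((m - (i : ℤ)).negOnePow : ℤ) * Ring.choose m i) • Φ (α + (m : ℂ) - (i : ℂ)) (Y₁ a i w)

/-- The coefficient of `x^(-α-1)` in
`(a(m) ∘ Φ)(x) w = Res_{x₁} ((x₁-x)^m Y_{M₂}(a,x₁) Φ(x) w - (-x+x₁)^m Φ(x) Y_{M₁}(a,x₁) w)`. -/
noncomputable def circCoeff (Y₁ : Modes V M₁) (Y₂ : Modes V M₂) (a : V) (m : ℤ)
    (Φ : ℂ → (M₁ →ₗ[ℂ] M₂)) (α : ℂ) (w : M₁) : M₂ :=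
  (∑ᶠ i : ℕ, circLeft Y₂ a m Φ α w i) - ∑ᶠ i : ℕ, circRight Y₁ a m Φ α w i

theorem circLeft_eventually (Y₂ : Modes V M₂) (a : V) (m : ℤ) (Φ : truncatedSeries M₁ M₂) (α : ℂ)
    (w : M₁) : ∃ N : ℤ, ∀ i : ℕ, N ≤ i → circLeft Y₂ a m Φ.1 α w i = 0 := by
  obtain ⟨N, hN⟩ := Φ.2 α w
  refine ⟨N, fun i hi => ?_⟩
  have := hN i hi
  rw [Int.cast_natCast] at this
  rw [circLeft, this, map_zero, smul_zero]

theorem circRight_eventually {Y₁ : Modes V M₁} (h₁ : Truncated Y₁) (a : V) (m : ℤ)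
    (Φ : ℂ → (M₁ →ₗ[ℂ] M₂)) (α : ℂ)
    (w : M₁) : ∃ N : ℤ, ∀ i : ℕ, N ≤ i → circRight Y₁ a m Φ α w i = 0 := by
  obtain ⟨N, hN⟩ := h₁ a w
  refine ⟨N, fun i hi => ?_⟩
  rw [circRight, hN i hi, map_zero, smul_zero]

/-- The series `(a(m) ∘ Φ)(x)`, as an element of `Hom(M₁, M₂){x}`. -/
noncomputable def circSeries {Y₁ : Modes V M₁} (h₁ : Truncated Y₁) (Y₂ : Modes V M₂) (a : V)
    (m : ℤ) (Φ : truncatedSeries M₁ M₂) : ℂ → (M₁ →ₗ[ℂ] M₂) := fun α =>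
  { toFun := circCoeff Y₁ Y₂ a m Φ.1 α
    map_add' := fun w w' => by
      have e1 : circLeft Y₂ a m Φ.1 α (w + w') =
          fun i => circLeft Y₂ a m Φ.1 α w i + circLeft Y₂ a m Φ.1 α w' i := by
        funext i
        simp [circLeft]
      have e2 : circRight Y₁ a m Φ.1 α (w + w') =
          fun i => circRight Y₁ a m Φ.1 α w i + circRight Y₁ a m Φ.1 α w' i := by
        funext i
        simp [circRight]
      rw [circCoeff, e1, e2, finsum_add_of_eventually_zero (circLeft_eventually Y₂ a m Φ α w)
        (circLeft_eventually Y₂ a m Φ α w'), finsum_add_of_eventually_zero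
        (circRight_eventually h₁ a m Φ.1 α w) (circRight_eventually h₁ a m Φ.1 α w'),
        circCoeff, circCoeff]
      abel
    map_smul' := fun c w => by
      have e1 : circLeft Y₂ a m Φ.1 α (c • w) = fun i => c • circLeft Y₂ a m Φ.1 α w i := by
        funext i
        simp [circLeft, smul_comm c]
      have e2 : circRight Y₁ a m Φ.1 α (c • w) = fun i => c • circRight Y₁ a m Φ.1 α w i := by
        funext i
        simp [circRight, smul_comm c]
      rw [circCoeff, e1, e2, ← smul_finsum, ← smul_finsum, ← smul_sub]
      rfl }

theorem circSeries_mem {Y₁ : Modes V M₁} (h₁ : Truncated Y₁) (Y₂ : Modes V M₂) (a : V)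
    (m : ℤ) (Φ : truncatedSeries M₁ M₂) : circSeries h₁ Y₂ a m Φ ∈ truncatedSeries M₁ M₂ := by
  intro α w
  obtain ⟨N, hN⟩ := Φ.2 α w
  obtain ⟨K, hK⟩ := h₁ a w
  choose P hP using fun i : ℕ => Φ.2 (α + (m : ℂ) - (i : ℂ)) (Y₁ a i w)
  refine ⟨max N (∑ i ∈ Finset.range K.toNat, |P i|), fun n hn => ?_⟩
  have hz1 : ∀ i : ℕ, circLeft Y₂ a m Φ.1 (α + n) w i = 0 := by
    intro i
    have h1 := hN (n + i) (by have := le_max_left N (∑ i ∈ Finset.range K.toNat, |P i|); omega)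
    have h2 : α + (n : ℂ) + (i : ℂ) = α + ((n + (i : ℤ) : ℤ) : ℂ) := by
      push_cast
      ring
    rw [circLeft, h2, h1, map_zero, smul_zero]
  have hz2 : ∀ i : ℕ, circRight Y₁ a m Φ.1 (α + n) w i = 0 := by
    intro i
    by_cases hi : K ≤ i
    · rw [circRight, hK i hi, map_zero, smul_zero]
    · have hmem : i ∈ Finset.range K.toNat := by
        rw [Finset.mem_range]
        omega
      have hle := Finset.single_le_sum (f := fun i => |P i|) (fun j _ => abs_nonneg (P j)) hmem
      have h1 := hP i n (le_trans (le_abs_self _) (le_trans hle (le_trans (le_max_right _ _) hn)))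
      have h2 : α + (n : ℂ) + (m : ℂ) - (i : ℂ) = α + (m : ℂ) - (i : ℂ) + (n : ℂ) := by ring
      rw [circRight, h2, h1, smul_zero]
  change circCoeff Y₁ Y₂ a m Φ.1 (α + n) w = 0
  simp [circCoeff, hz1, hz2]

/-- The action `Φ ↦ a(m) ∘ Φ` of the modes `a(m)`, `a ∈ V`, on the truncated series. -/
noncomputable def circ {Y₁ : Modes V M₁} (h₁ : Truncated Y₁) (Y₂ : Modes V M₂) :
    Modes V (truncatedSeries M₁ M₂) where
  toFun a m :=
    { toFun := fun Φ => ⟨circSeries h₁ Y₂ a m Φ, circSeries_mem h₁ Y₂ a m Φ⟩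
      map_add' := fun Φ Ψ => by
        apply Subtype.ext
        funext α
        ext w
        change circCoeff Y₁ Y₂ a m (Φ + Ψ).1 α w =
          circCoeff Y₁ Y₂ a m Φ.1 α w + circCoeff Y₁ Y₂ a m Ψ.1 α w
        have e1 : circLeft Y₂ a m (Φ + Ψ).1 α w =
            fun i => circLeft Y₂ a m Φ.1 α w i + circLeft Y₂ a m Ψ.1 α w i := by
          funext i
          simp [circLeft]
        have e2 : circRight Y₁ a m (Φ + Ψ).1 α w =
            fun i => circRight Y₁ a m Φ.1 α w i + circRight Y₁ a m Ψ.1 α w i := by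
          funext i
          simp [circRight]
        rw [circCoeff, e1, e2, finsum_add_of_eventually_zero (circLeft_eventually Y₂ a m Φ α w)
          (circLeft_eventually Y₂ a m Ψ α w), finsum_add_of_eventually_zero
          (circRight_eventually h₁ a m Φ.1 α w) (circRight_eventually h₁ a m Ψ.1 α w),
          circCoeff, circCoeff]
        abel
      map_smul' := fun c Φ => by
        apply Subtype.ext
        funext α
        ext w
        change circCoeff Y₁ Y₂ a m (c • Φ).1 α w = c • circCoeff Y₁ Y₂ a m Φ.1 α w
        have e1 : circLeft Y₂ a m (c • Φ).1 α w = fun i => c • circLeft Y₂ a m Φ.1 α w i := by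
          funext i
          simp [circLeft, smul_comm c]
        have e2 : circRight Y₁ a m (c • Φ).1 α w = fun i => c • circRight Y₁ a m Φ.1 α w i := by
          funext i
          simp [circRight, smul_comm c]
        rw [circCoeff, e1, e2, ← smul_finsum, ← smul_finsum, ← smul_sub]
        rfl }
  map_add' a b := by
    funext m
    ext Φ α w
    change circCoeff Y₁ Y₂ (a + b) m Φ.1 α w =
      circCoeff Y₁ Y₂ a m Φ.1 α w + circCoeff Y₁ Y₂ b m Φ.1 α w
    have e1 : circLeft Y₂ (a + b) m Φ.1 α w =
        fun i => circLeft Y₂ a m Φ.1 α w i + circLeft Y₂ b m Φ.1 α w i := by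
      funext i
      simp [circLeft]
    have e2 : circRight Y₁ (a + b) m Φ.1 α w =
        fun i => circRight Y₁ a m Φ.1 α w i + circRight Y₁ b m Φ.1 α w i := by
      funext i
      simp [circRight]
    rw [circCoeff, e1, e2, finsum_add_of_eventually_zero (circLeft_eventually Y₂ a m Φ α w)
      (circLeft_eventually Y₂ b m Φ α w), finsum_add_of_eventually_zero
      (circRight_eventually h₁ a m Φ.1 α w) (circRight_eventually h₁ b m Φ.1 α w),
      circCoeff, circCoeff]
    abel
  map_smul' c a := by
    funext m
    ext Φ α w
    change circCoeff Y₁ Y₂ (c • a) m Φ.1 α w = c • circCoeff Y₁ Y₂ a m Φ.1 α w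
    have e1 : circLeft Y₂ (c • a) m Φ.1 α w = fun i => c • circLeft Y₂ a m Φ.1 α w i := by
      funext i
      simp [circLeft, smul_comm c]
    have e2 : circRight Y₁ (c • a) m Φ.1 α w = fun i => c • circRight Y₁ a m Φ.1 α w i := by
      funext i
      simp [circRight, smul_comm c]
    rw [circCoeff, e1, e2, ← smul_finsum, ← smul_finsum, ← smul_sub]
    rfl

end Generalized

section Delta

variable {V : Type u} [AddCommGroup V] [Module ℂ V] {A : VertexOperatorAlgebra V}

/-- The space `G(W₁, W₂)` for two `V`-modules. -/
def G (W₁ W₂ : VModule.{u, v} A) : Submodule ℂ (truncatedSeries W₁.carrier W₂.carrier) :=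
  generalizedIntertwining A W₁.Y W₂.Y

/-- The action of `V` on truncated series whose restriction makes `G(W₁, W₂)` a weak module. -/
noncomputable def action (W₁ W₂ : VModule.{u, v} A) :
    Modes V (truncatedSeries W₁.carrier W₂.carrier) :=
  circ W₁.isModule.truncated W₂.Y

/-- `N` is a `V`-module inside `G(W₁, W₂)`: a subspace of `G(W₁, W₂)` which is closed under the
action and which is a `V`-module under the restricted action. -/
def IsModuleInside (W₁ W₂ : VModule.{u, v} A)
    (N : Submodule ℂ (truncatedSeries W₁.carrier W₂.carrier)) : Prop :=
  N ≤ G W₁ W₂ ∧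
    ∃ h : IsStable (action W₁ W₂) N, IsModule A (restrict (action W₁ W₂) N h)

/-- `Δ(W₁, W₂)`, the sum of all `V`-modules inside `G(W₁, W₂)`. -/
noncomputable def Delta (W₁ W₂ : VModule.{u, v} A) :
    Submodule ℂ (truncatedSeries W₁.carrier W₂.carrier) :=
  sSup {N | IsModuleInside W₁ W₂ N}

/-- Up to equivalence there are only finitely many irreducible `V`-modules. -/
def FinitelyManyIrreducibles (A : VertexOperatorAlgebra V) : Prop :=
  ∃ S : Set (VModule.{u, v} A), S.Finite ∧
    ∀ M : VModule.{u, v} A, IsIrreducible M.Y → ∃ N ∈ S, Equivalent M.Y N.Y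

/-- All fusion rules for three `V`-modules are finite. -/
def FiniteFusionRules (A : VertexOperatorAlgebra V) : Prop :=
  ∀ M₁ M₂ M₃ : VModule.{u, v} A,
    FiniteDimensional ℂ (intertwiningOperators A M₁.Y M₂.Y M₃.Y
      M₁.isModule.toIsWeakModule M₂.isModule.toIsWeakModule M₃.isModule.toIsWeakModule)

end Delta

end VOA

/-! A linear map `g : M → G(W₁, W₂)` commuting with all modes yields the intertwining operator `I(u,
x) = g(u)(x)` of type `(W₂ over M W₁)`, and `g` can be read off from `I`. So Hom(M, G(W₁, W₂))
embeds in a space of intertwining operators and is finite-dimensional when fusion rules are finite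
(`finiteDimensional_homG`).

By complete reducibility, a module inside `G(W₁, W₂)` is a sum of irreducibles, each the image of a
homomorphism from one of finitely many representatives. Each representative contributes only the
images of a finite spanning set of homomorphisms. Hence one finite sum of images contains every
module inside `G(W₁, W₂)`. A finite sum of modules is a quotient of a finite direct sum, so it is
again a module; it must equal `Delta W₁ W₂`.

The substance is the Jacobi identity for `I` (`jacobi_of_equivariant`). Its defect `D l m α` obeys a
recurrence expressing `x₀ = x₁ - x₂`. It vanishes at `m = 0` by the definition of the action, and
for large `l` by locality and truncation; these two facts propagate to all `l`, `m`, `α`. -/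

namespace VOA

/-! ### Pascal's rule for sums with generalized binomial coefficients -/

section Pascal

variable {E : Type*} [AddCommGroup E]

/-- Pascal's rule followed by an index shift. It serves all three sums of the Jacobi identity and
holds for negative `l` too. Finite support is essential, since a `finsum` with infinite support
defaults to `0`. -/
theorem finsum_choose_succ_smul (l : ℤ) {F : ℕ → E} (hF : F.support.Finite) :
    ∑ᶠ i : ℕ, Ring.choose (l + 1) i • F i =
      ∑ᶠ i : ℕ, Ring.choose l i • F i + ∑ᶠ i : ℕ, Ring.choose l i • F (i + 1) := by
  obtain ⟨N, hN⟩ : ∃ N : ℕ, ∀ i, N ≤ i → F i = 0 := by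
    obtain ⟨N, hN⟩ := hF.bddAbove
    refine ⟨N + 1, fun i hi => ?_⟩
    by_contra h
    have := hN h
    omega
  have key : ∀ (c : ℕ → ℤ) (G : ℕ → E), (∀ i, N ≤ i → G i = 0) →
      ∑ᶠ i : ℕ, c i • G i = ∑ i ∈ Finset.range (N + 1), c i • G i := by
    intro c G hG
    refine finsum_eq_sum_of_support_subset _ fun i hi => ?_
    by_contra h
    simp only [Finset.coe_range, Set.mem_Iio, not_lt] at h
    exact hi (by simp [hG i (by omega)])
  rw [key _ _ hN, key _ _ hN, key _ _ fun i hi => hN (i + 1) (by omega),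
    Finset.sum_range_succ', Finset.sum_range_succ' (fun i => Ring.choose l i • F i),
    Finset.sum_range_succ (fun i => Ring.choose l i • F (i + 1)), hN (N + 1) (by omega)]
  simp only [Ring.choose_succ_succ, add_smul, Finset.sum_add_distrib, Ring.choose_zero_right,
    smul_zero]
  abel

theorem finsum_choose_zero_smul (F : ℕ → E) : ∑ᶠ i : ℕ, Ring.choose (0 : ℤ) i • F i = F 0 := by
  rw [finsum_eq_single _ 0 fun i hi => by
    rw [Ring.choose_zero_pos ℤ (Nat.pos_of_ne_zero hi), zero_smul]]
  simp

end Pascal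

/-! ### From equivariant maps into `G(W₁, W₂)` to intertwining operators -/

section JacobiIdentity

variable {V : Type u} [AddCommGroup V] [Module ℂ V] {M M₁ M₂ : Type*}
  [AddCommGroup M] [Module ℂ M] [AddCommGroup M₁] [Module ℂ M₁] [AddCommGroup M₂] [Module ℂ M₂]

/-- The first sum in the Jacobi identity for the series `Φ`. -/
noncomputable def jacobiLeft (Y₂ : Modes V M₂) (a : V) (Φ : ℂ → (M₁ →ₗ[ℂ] M₂)) (w : M₁)
    (l m : ℤ) (α : ℂ) : M₂ :=
  ∑ᶠ i : ℕ, ((-1 : ℤ) ^ i * Ring.choose l i) • Y₂ a (m + l - i) (Φ (α + (i : ℂ)) w)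

/-- The second sum in the Jacobi identity for the series `Φ`. -/
noncomputable def jacobiRight (Y₁ : Modes V M₁) (a : V) (Φ : ℂ → (M₁ →ₗ[ℂ] M₂)) (w : M₁)
    (l m : ℤ) (α : ℂ) : M₂ :=
  ∑ᶠ i : ℕ, (((l - (i : ℤ)).negOnePow : ℤ) * Ring.choose l i) •
    Φ (α + (l : ℂ) - (i : ℂ)) (Y₁ a (m + i) w)

/-- The sum over iterates in the Jacobi identity. -/
noncomputable def jacobiIterate (Y : Modes V M) (I : M →ₗ[ℂ] (ℂ → (M₁ →ₗ[ℂ] M₂))) (a : V) (u : M)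
    (w : M₁) (l m : ℤ) (α : ℂ) : M₂ :=
  ∑ᶠ i : ℕ, (Ring.choose m i) • I (Y a (l + i) u) ((m : ℂ) + α - (i : ℂ)) w

/-- Coefficient form of `(x₁ - x₂)^(l+1) = (x₁ - x₂) (x₁ - x₂)^l`: raising `m` is multiplication by
`x₁`, raising `α` is multiplication by `x₂`. -/
theorem jacobiLeft_succ (Y₂ : Modes V M₂) (a : V) (Φ : truncatedSeries M₁ M₂) (w : M₁)
    (l m : ℤ) (α : ℂ) :
    jacobiLeft Y₂ a Φ.1 w (l + 1) m α =
      jacobiLeft Y₂ a Φ.1 w l (m + 1) α - jacobiLeft Y₂ a Φ.1 w l m (α + 1) := by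
  have hF : (fun i : ℕ => (-1 : ℤ) ^ i •
      Y₂ a (m + (l + 1) - i) (Φ.1 (α + (i : ℂ)) w)).support.Finite := by
    obtain ⟨N, hN⟩ := Φ.2 α w
    refine finite_support_of_eventually_zero ⟨N, fun i hi => ?_⟩
    have := hN i hi
    rw [Int.cast_natCast] at this
    rw [this, map_zero, smul_zero]
  have := finsum_choose_succ_smul l hF
  simp only [smul_smul] at this
  simp only [jacobiLeft, sub_eq_add_neg (∑ᶠ _, _), ← finsum_neg_distrib]
  convert this using 1
  · simp only [mul_comm]
  · congr 1 <;> refine finsum_congr fun i => ?_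
    · rw [mul_comm, show m + 1 + l - (i : ℤ) = m + (l + 1) - i by ring]
    · rw [← neg_smul]
      congr 1
      · ring
      · congr 2
        · push_cast; ring_nf
        · push_cast; ring_nf

/-- The same factorization for the expansion `(-x₂ + x₁)^l`, in powers of `x₁`. -/
theorem jacobiRight_succ {Y₁ : Modes V M₁} (h₁ : Truncated Y₁) (a : V)
    (Φ : ℂ → (M₁ →ₗ[ℂ] M₂)) (w : M₁) (l m : ℤ) (α : ℂ) :
    jacobiRight Y₁ a Φ w (l + 1) m α =
      jacobiRight Y₁ a Φ w l (m + 1) α - jacobiRight Y₁ a Φ w l m (α + 1) := by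
  have hF : (fun i : ℕ => ((l + 1 - (i : ℤ)).negOnePow : ℤ) •
      Φ (α + ((l + 1 : ℤ) : ℂ) - (i : ℂ)) (Y₁ a (m + i) w)).support.Finite := by
    obtain ⟨N, hN⟩ := h₁ a w
    refine finite_support_of_eventually_zero ⟨N - m, fun i hi => ?_⟩
    rw [hN (m + i) (by omega), map_zero, smul_zero]
  have := finsum_choose_succ_smul l hF
  simp only [smul_smul] at this
  -- Here the shifted sum carries the factor `x₁` and the unshifted one `-x₂`, the reverse of the
  -- first expansion.
  rw [add_comm (∑ᶠ _, _)] at this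
  simp only [jacobiRight, sub_eq_add_neg (∑ᶠ _, _), ← finsum_neg_distrib]
  convert this using 1
  · simp only [mul_comm]
  · congr 1 <;> refine finsum_congr fun i => ?_
    · rw [mul_comm, show l + 1 - ((i + 1 : ℕ) : ℤ) = l - i by push_cast; ring,
        show m + 1 + (i : ℤ) = m + (i + 1 : ℕ) by push_cast; ring]
      congr 3
      push_cast; ring_nf
    · rw [← neg_smul, show l + 1 - (i : ℤ) = l - i + 1 by ring, Int.negOnePow_succ]
      congr 1
      · push_cast; ring_nf
      · congr 2
        push_cast; ring_nf

/-- On the iterate side `x₁` acts as `x₂ + x₀`, and raising `l` is multiplication by `x₀`. -/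
theorem jacobiIterate_succ {Y : Modes V M} (h : Truncated Y) (I : M →ₗ[ℂ] (ℂ → (M₁ →ₗ[ℂ] M₂)))
    (a : V) (u : M) (w : M₁) (l m : ℤ) (α : ℂ) :
    jacobiIterate Y I a u w l (m + 1) α =
      jacobiIterate Y I a u w l m (α + 1) + jacobiIterate Y I a u w (l + 1) m α := by
  have hF : (fun i : ℕ =>
      I (Y a (l + i) u) (((m + 1 : ℤ) : ℂ) + α - (i : ℂ)) w).support.Finite := by
    obtain ⟨N, hN⟩ := h a u
    refine finite_support_of_eventually_zero ⟨N - l, fun i hi => ?_⟩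
    rw [hN (l + i) (by omega)]
    simp
  refine (finsum_choose_succ_smul m hF).trans ?_
  simp only [jacobiIterate]
  congr 1 <;> refine finsum_congr fun i => ?_
  · congr 3
    push_cast; ring_nf
  · rw [show l + ((i + 1 : ℕ) : ℤ) = l + 1 + i by push_cast; ring]
    congr 3
    push_cast; ring_nf

/-- For `l ≥ 0` the binomial is a polynomial, so the Jacobi sum is a coefficient of the product
appearing in the locality condition. -/
theorem jacobiLeft_natCast (Y₂ : Modes V M₂) (a : V) (Φ : truncatedSeries M₁ M₂) (w : M₁)
    (l : ℕ) (m : ℤ) (α : ℂ) :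
    jacobiLeft Y₂ a Φ.1 w l m α =
      (mulSub (M₁ →ₗ[ℂ] M₂) ^ l) (leftProduct Y₂ a Φ.1) m α w := by
  induction l generalizing m α with
  | zero =>
    have := finsum_choose_zero_smul fun i : ℕ => (-1 : ℤ) ^ i • Y₂ a (m - i) (Φ.1 (α + (i : ℂ)) w)
    simp only [smul_smul, mul_comm (Ring.choose _ _)] at this
    simpa [jacobiLeft, leftProduct] using this
  | succ l ih =>
    rw [Nat.cast_succ, jacobiLeft_succ, ih, ih, pow_succ', Module.End.mul_apply]
    rfl

theorem jacobiRight_natCast {Y₁ : Modes V M₁} (h₁ : Truncated Y₁) (a : V)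
    (Φ : ℂ → (M₁ →ₗ[ℂ] M₂)) (w : M₁) (l : ℕ) (m : ℤ) (α : ℂ) :
    jacobiRight Y₁ a Φ w l m α =
      (mulSub (M₁ →ₗ[ℂ] M₂) ^ l) (rightProduct Y₁ a Φ) m α w := by
  induction l generalizing m α with
  | zero =>
    have := finsum_choose_zero_smul fun i : ℕ =>
      ((-(i : ℤ)).negOnePow : ℤ) • Φ (α - (i : ℂ)) (Y₁ a (m + i) w)
    simp only [smul_smul, mul_comm (Ring.choose _ _)] at this
    simpa [jacobiRight, rightProduct] using this
  | succ l ih =>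
    rw [Nat.cast_succ, jacobiRight_succ h₁, ih, ih, pow_succ', Module.End.mul_apply]
    rfl

/-- Locality of the series in the image of `g`, together with the iterate formula, implies the
Jacobi identity. -/
theorem jacobi_of_equivariant {A : VertexOperatorAlgebra V} {Y : Modes V M} {Y₁ : Modes V M₁}
    {Y₂ : Modes V M₂} (h : Truncated Y) (h₁ : Truncated Y₁)
    (g : M →ₗ[ℂ] truncatedSeries M₁ M₂)
    (hg : ∀ a n u, g (Y a n u) = circ h₁ Y₂ a n (g u))
    (hG : ∀ u, g u ∈ generalizedIntertwining A Y₁ Y₂) :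
    Jacobi Y Y₁ Y₂ ((truncatedSeries M₁ M₂).subtype ∘ₗ g) := by
  intro a u w l m α
  set I := (truncatedSeries M₁ M₂).subtype ∘ₗ g with hI
  change jacobiLeft Y₂ a (g u).1 w l m α - jacobiRight Y₁ a (g u).1 w l m α =
    jacobiIterate Y I a u w l m α
  set D : ℤ → ℤ → ℂ → M₂ := fun l m α => jacobiLeft Y₂ a (g u).1 w l m α -
    jacobiRight Y₁ a (g u).1 w l m α - jacobiIterate Y I a u w l m α with hD
  suffices hz : ∀ m l α, D l m α = 0 from sub_eq_zero.mp (hz m l α)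
  -- All three sums satisfy the relation `x₀ = x₁ - x₂`, hence so does their difference.
  have hrec : ∀ l m α, D (l + 1) m α = D l (m + 1) α - D l m (α + 1) := by
    intro l m α
    simp only [hD]
    rw [jacobiLeft_succ, jacobiRight_succ h₁, jacobiIterate_succ h]
    abel
  -- At `m = 0` only the term `i = 0` of the iterate sum survives, and the identity is the
  -- definition of `a(l) ∘ Φ`.
  have hzero : ∀ l α, D l 0 α = 0 := by
    intro l α
    have e : jacobiIterate Y I a u w l 0 α = circCoeff Y₁ Y₂ a l (g u).1 α w := by
      have := finsum_choose_zero_smul fun i : ℕ =>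
        I (Y a (l + i) u) (((0 : ℤ) : ℂ) + α - (i : ℂ)) w
      refine this.trans ?_
      simp only [hI, LinearMap.comp_apply, Submodule.subtype_apply, hg, Nat.cast_zero, add_zero,
        Int.cast_zero, zero_add, sub_zero]
      rfl
    simp only [hD, e, circCoeff, jacobiLeft, jacobiRight, circLeft, circRight, zero_add, sub_self]
  obtain ⟨N, hN⟩ := h a u
  obtain ⟨k, -, hk⟩ := (hG u).2 a
  -- For `l ≥ N` truncation kills the iterates; for `l ≥ k` locality equates the two products.
  have hlarge : ∀ l : ℕ, k ≤ l → N ≤ l → ∀ m α, D l m α = 0 := by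
    intro l hkl hNl m α
    have e1 : jacobiIterate Y I a u w l m α = 0 := by
      refine (finsum_congr fun i => ?_).trans finsum_zero
      rw [hN _ (by omega)]
      simp
    obtain ⟨j, rfl⟩ := Nat.exists_eq_add_of_le' hkl
    simp only [hD]
    rw [e1, jacobiLeft_natCast, jacobiRight_natCast h₁, pow_add, Module.End.mul_apply,
      Module.End.mul_apply, hk, sub_self, sub_zero]
  intro m
  induction m using Int.induction_on with
  | zero => exact hzero
  | succ m ih =>
    intro l α
    have := hrec l m α
    rw [ih, ih, sub_zero] at this
    exact this.symm
  | pred m ih =>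
    -- Going down in `m`, the recurrence only trades a shift of `α` for a shift of `l`. Vanishing
    -- therefore descends from `l + 1` to `l`, starting from large `l`.
    have hstep : ∀ l α, D l (-(m : ℤ) - 1) (α + 1) = -D (l + 1) (-(m : ℤ) - 1) α := by
      intro l α
      have := hrec l (-(m : ℤ) - 1) α
      rw [sub_add_cancel, ih, zero_sub] at this
      rw [this, neg_neg]
    have hdown : ∀ (j : ℕ) (l : ℤ), (∀ α, D (l + j) (-(m : ℤ) - 1) α = 0) →
        ∀ α, D l (-(m : ℤ) - 1) α = 0 := by
      intro j
      induction j with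
      | zero => intro l hl; simpa using hl
      | succ j ihj =>
        intro l hl
        refine ihj l fun α => ?_
        rw [← sub_add_cancel α 1, hstep, neg_eq_zero]
        simpa [add_assoc] using hl (α - 1)
    intro l
    -- A natural number that is at least each of `l`, `k` and `N`.
    have hl := hlarge (l.natAbs + k + N.natAbs) (by omega) (by omega) (-(m : ℤ) - 1)
    refine hdown (((l.natAbs + k + N.natAbs : ℕ) : ℤ) - l).toNat l fun α => ?_
    rw [Int.toNat_of_nonneg (by omega), add_sub_cancel]
    exact hl α

/-- Truncation is (G1). The derivative property is (G2), because `ω(0) ∘ Φ = [L(-1), Φ]`: at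
exponent `0` both binomials equal `1`. -/
theorem isIntertwining_of_equivariant {A : VertexOperatorAlgebra V} {Y : Modes V M}
    {Y₁ : Modes V M₁} {Y₂ : Modes V M₂} (h : Truncated Y) (h₁ : Truncated Y₁)
    (g : M →ₗ[ℂ] truncatedSeries M₁ M₂)
    (hg : ∀ a n u, g (Y a n u) = circ h₁ Y₂ a n (g u))
    (hG : ∀ u, g u ∈ generalizedIntertwining A Y₁ Y₂) :
    IsIntertwining A Y Y₁ Y₂ ((truncatedSeries M₁ M₂).subtype ∘ₗ g) where
  truncated u w α := (g u).2 α w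
  derivative u w α := by
    have e : circCoeff Y₁ Y₂ A.ω 0 (g u).1 α w =
        Y₂ A.ω 0 ((g u).1 α w) - (g u).1 α (Y₁ A.ω 0 w) := by
      have e1 := jacobiLeft_natCast Y₂ A.ω (g u) w 0 0 α
      have e2 := jacobiRight_natCast h₁ A.ω (g u).1 w 0 0 α
      simp only [jacobiLeft, jacobiRight, Nat.cast_zero, zero_add, pow_zero,
        Module.End.one_apply] at e1 e2
      simp only [circCoeff, circLeft, circRight]
      rw [e1, e2]
      rfl
    have := LinearMap.congr_fun ((hG u).1 α) w
    simp only [LinearMap.comp_apply, hg]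
    exact e.trans this
  jacobi := jacobi_of_equivariant h h₁ g hg hG

end JacobiIdentity

/-! ### Eigenspace decompositions of quotients and stable subspaces -/

section Eigenspaces

variable {M M' : Type*} [AddCommGroup M] [Module ℂ M] [AddCommGroup M'] [Module ℂ M']

/-- The images of the components and the family concentrated at `h₀` both consist of eigenvectors
and have the same sum, so independence of eigenspaces makes them agree. -/
theorem map_component_of_map_mem_eigenspace {f : Module.End ℂ M} {f' : Module.End ℂ M'}
    {π : M →ₗ[ℂ] M'} (hπ : ∀ u, π (f u) = f' (π u)) {x : ℂ →₀ M}
    (hx : ∀ h, x h ∈ f.eigenspace h) {h₀ : ℂ}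
    (hu : π (x.sum fun _ y => y) ∈ f'.eigenspace h₀) (h : ℂ) :
    π (x h) = if h = h₀ then π (x.sum fun _ y => y) else 0 := by
  classical
  have hmem : ∀ h, π (x h) ∈ f'.eigenspace h := by
    intro h
    rw [Module.End.mem_eigenspace_iff, ← hπ, Module.End.mem_eigenspace_iff.mp (hx h), map_smul]
  have hind := (iSupIndep_iff_finsetSum_eq_imp_eq _).mp f'.eigenspaces_iSupIndep
    (insert h (insert h₀ x.support)) (fun h => π (x h))
    (fun h => if h = h₀ then π (x.sum fun _ y => y) else 0)
    (fun i _ => ⟨hmem i, by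
      split_ifs with hi
      · exact hi ▸ hu
      · exact zero_mem _⟩) ?_
  · exact hind h (Finset.mem_insert_self _ _)
  · rw [Finset.sum_ite_eq' , if_pos (by simp), Finsupp.sum, map_sum]
    refine (Finset.sum_subset (fun i hi => by simp [Finsupp.mem_support_iff.mp hi]) ?_).symm
    intro i _ hi
    rw [Finsupp.notMem_support_iff.mp hi, map_zero]

theorem eigenspace_le_map_of_surjective {f : Module.End ℂ M} {f' : Module.End ℂ M'}
    {π : M →ₗ[ℂ] M'} (hπ : ∀ u, π (f u) = f' (π u)) (hs : Function.Surjective π)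
    (htop : ⨆ h, f.eigenspace h = ⊤) (h : ℂ) :
    f'.eigenspace h ≤ (f.eigenspace h).map π := by
  intro v hv
  obtain ⟨u, rfl⟩ := hs v
  obtain ⟨x, hx, rfl⟩ := (Submodule.mem_iSup_iff_exists_finsupp _ _).mp
    (htop ▸ Submodule.mem_top : u ∈ ⨆ h, f.eigenspace h)
  exact ⟨x h, hx h, (map_component_of_map_mem_eigenspace hπ hx hv h).trans (if_pos rfl)⟩

/-- A vector of `N` has image `0` in `M ⧸ N`, so each of its eigencomponents also has image `0` and
thus lies in `N`. -/
theorem iSup_eigenspace_restrict_of_stable {f : Module.End ℂ M} {N : Submodule ℂ M}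
    (hN : ∀ x ∈ N, f x ∈ N) (htop : ⨆ h, f.eigenspace h = ⊤) :
    ⨆ h, Module.End.eigenspace (f.restrict hN) h = ⊤ := by
  refine eq_top_iff.mpr fun u _ => ?_
  obtain ⟨x, hx, hxu⟩ := (Submodule.mem_iSup_iff_exists_finsupp _ _).mp
    (htop ▸ Submodule.mem_top : (u : M) ∈ ⨆ h, f.eigenspace h)
  have hq : N.mkQ (x.sum fun _ y => y) = 0 := by
    rw [hxu]
    simp
  have hxN : ∀ h, x h ∈ N := by
    intro h
    -- The choice `h₀ := 0` is arbitrary: the zero vector lies in every eigenspace.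
    have := map_component_of_map_mem_eigenspace (f' := N.mapQ N f hN) (π := N.mkQ)
      (fun u => by simp) hx (h₀ := 0) (by rw [hq]; exact zero_mem _) h
    rw [hq, ite_self] at this
    simpa using this
  have hsum : u = ∑ h ∈ x.support, (⟨x h, hxN h⟩ : N) := by
    apply Subtype.ext
    rw [← hxu, Finsupp.sum]
    simp
  rw [hsum]
  refine Submodule.sum_mem _ fun h _ => Submodule.mem_iSup_of_mem h ?_
  rw [Module.End.mem_eigenspace_iff]
  exact Subtype.ext (Module.End.mem_eigenspace_iff.mp (hx h))

end Eigenspaces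

/-! ### Quotients, submodules and direct sums of modules -/

section Constructions

variable {V : Type u} [AddCommGroup V] [Module ℂ V] {A : VertexOperatorAlgebra V}
  {M M' : Type*} [AddCommGroup M] [Module ℂ M] [AddCommGroup M'] [Module ℂ M']

/-- `g` commutes with the action of all modes. -/
def IsEquivariant (Y : Modes V M) (Y' : Modes V M') (g : M →ₗ[ℂ] M') : Prop :=
  ∀ (a : V) (n : ℤ) (x : M), g (Y a n x) = Y' a n (g x)

/-- The difference of the two sides of the Jacobi identity for the modes `Y`. -/
noncomputable def jacobiDefect (A : VertexOperatorAlgebra V) (Y : Modes V M) (a b : V) (w : M)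
    (l m α : ℤ) : M :=
  (∑ᶠ i : ℕ, ((-1 : ℤ) ^ i * Ring.choose l i) • Y a (m + l - i) (Y b (α + (i : ℤ)) w))
    - (∑ᶠ i : ℕ, (((l - (i : ℤ)).negOnePow : ℤ) * Ring.choose l i) •
        Y b (α + (l : ℤ) - (i : ℤ)) (Y a (m + i) w))
    - ∑ᶠ i : ℕ, (Ring.choose m i) • Y (A.Y a (l + i) b) ((m : ℤ) + α - (i : ℤ)) w

theorem jacobi_iff_jacobiDefect {Y : Modes V M} :
    Jacobi A.Y Y Y Y ↔ ∀ a b w l m α, jacobiDefect A Y a b w l m α = 0 :=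
  forall_congr' fun _ => forall_congr' fun _ => forall_congr' fun _ => forall_congr' fun _ =>
    forall_congr' fun _ => forall_congr' fun _ => sub_eq_zero.symm

/-- Truncation makes the three sums finite, so `g` passes through them. The Jacobi identity thereby
transfers along surjections, injections and jointly injective projections. -/
theorem IsEquivariant.map_jacobiDefect {Y : Modes V M} {Y' : Modes V M'} {g : M →ₗ[ℂ] M'}
    (hg : IsEquivariant Y Y' g) (hY : Truncated Y) (a b : V) (w : M) (l m α : ℤ) :
    g (jacobiDefect A Y a b w l m α) = jacobiDefect A Y' a b (g w) l m α := by
  have hmap : ∀ F : ℕ → M, (∃ N : ℤ, ∀ i : ℕ, N ≤ i → F i = 0) →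
      g (∑ᶠ i, F i) = ∑ᶠ i, g (F i) := fun F hF =>
    map_finsum g (finite_support_of_eventually_zero hF)
  obtain ⟨N, hN⟩ := hY b w
  obtain ⟨N', hN'⟩ := hY a w
  obtain ⟨K, hK⟩ := A.truncated a b
  rw [jacobiDefect, map_sub, map_sub, hmap _ ⟨N - α, fun i hi => ?_⟩,
    hmap _ ⟨N' - m, fun i hi => ?_⟩, hmap _ ⟨K - l, fun i hi => ?_⟩, jacobiDefect]
  · simp only [map_zsmul, hg _ _ _]
  · rw [hK _ (by omega)]
    simp
  · rw [hN' _ (by omega)]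
    simp
  · rw [hN _ (by omega)]
    simp

theorem IsWeakModule.of_surjective {Y : Modes V M} {Y' : Modes V M'} (h : IsWeakModule A Y)
    {g : M →ₗ[ℂ] M'} (hg : IsEquivariant Y Y' g) (hs : Function.Surjective g) :
    IsWeakModule A Y' where
  Y_one n := by
    ext x
    obtain ⟨u, rfl⟩ := hs x
    rw [← hg, h.Y_one]
    split_ifs <;> simp
  derivative a n := by
    ext x
    obtain ⟨u, rfl⟩ := hs x
    rw [← hg, h.derivative]
    simp [hg _ _ _]
  truncated a x := by
    obtain ⟨u, rfl⟩ := hs x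
    obtain ⟨N, hN⟩ := h.truncated a u
    exact ⟨N, fun n hn => by rw [← hg, hN n hn, map_zero]⟩
  jacobi := by
    rw [jacobi_iff_jacobiDefect]
    intro a b x l m α
    obtain ⟨u, rfl⟩ := hs x
    rw [← hg.map_jacobiDefect h.truncated, jacobi_iff_jacobiDefect.mp h.jacobi, map_zero]

/-- Each weight space of the quotient is covered by the image of the weight space of the same
weight, which gives finite dimension and the lower bound on weights. -/
theorem IsModule.of_surjective {Y : Modes V M} {Y' : Modes V M'} (h : IsModule A Y)
    {g : M →ₗ[ℂ] M'} (hg : IsEquivariant Y Y' g) (hs : Function.Surjective g) :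
    IsModule A Y' where
  toIsWeakModule := h.toIsWeakModule.of_surjective hg hs
  independent := Module.End.eigenspaces_iSupIndep _
  iSup_eq_top := by
    rw [eq_top_iff, ← LinearMap.range_eq_top.mpr hs, LinearMap.range_eq_map, ← h.iSup_eq_top,
      Submodule.map_iSup]
    refine iSup_mono fun μ => ?_
    rintro _ ⟨u, hu, rfl⟩
    refine Module.End.mem_eigenspace_iff.mpr ?_
    rw [← hg, Module.End.mem_eigenspace_iff.mp hu, map_smul]
  finiteDimensional μ := by
    have := h.finiteDimensional μ
    have : FiniteDimensional ℂ ((weightSpace A Y μ).map g) := inferInstance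
    exact Submodule.finiteDimensional_of_le (S₂ := (weightSpace A Y μ).map g)
      (eigenspace_le_map_of_surjective (hg A.ω 1) hs h.iSup_eq_top μ)
  weight_eq_bot μ := by
    obtain ⟨N, hN⟩ := h.weight_eq_bot μ
    refine ⟨N, fun n hn => ?_⟩
    rw [eq_bot_iff]
    refine (eigenspace_le_map_of_surjective (hg A.ω 1) hs h.iSup_eq_top _).trans ?_
    change (weightSpace A Y (μ + n)).map g ≤ ⊥
    rw [hN n hn, Submodule.map_bot]

theorem isEquivariant_subtype (Y : Modes V M) (N : Submodule ℂ M) (hN : IsStable Y N) :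
    IsEquivariant (restrict Y N hN) Y N.subtype := fun _ _ _ => rfl

theorem IsModule.restrict {Y : Modes V M} (h : IsModule A Y) (N : Submodule ℂ M)
    (hN : IsStable Y N) : IsModule A (restrict Y N hN) := by
  have htr : Truncated (VOA.restrict Y N hN) := fun a x => by
    obtain ⟨K, hK⟩ := h.truncated a x
    exact ⟨K, fun n hn => Subtype.ext (hK n hn)⟩
  have hle : ∀ μ, (weightSpace A (VOA.restrict Y N hN) μ).map N.subtype ≤ weightSpace A Y μ := by
    rintro μ _ ⟨u, hu, rfl⟩
    exact Module.End.mem_eigenspace_iff.mpr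
      (congrArg Subtype.val (Module.End.mem_eigenspace_iff.mp hu))
  refine { Y_one := fun n => ?_, derivative := fun a n => ?_, truncated := htr, jacobi := ?_,
           independent := Module.End.eigenspaces_iSupIndep _,
           iSup_eq_top := iSup_eigenspace_restrict_of_stable (hN A.ω 1) h.iSup_eq_top,
           finiteDimensional := fun μ => ?_, weight_eq_bot := fun μ => ?_ }
  · refine LinearMap.ext fun x => Subtype.ext ?_
    refine (LinearMap.congr_fun (h.Y_one n) x).trans ?_
    split_ifs <;> rfl
  · exact LinearMap.ext fun x => Subtype.ext (LinearMap.congr_fun (h.derivative a n) x)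
  · rw [jacobi_iff_jacobiDefect]
    intro a b x l m α
    apply N.injective_subtype
    rw [(isEquivariant_subtype Y N hN).map_jacobiDefect htr,
      jacobi_iff_jacobiDefect.mp h.jacobi, map_zero]
  · have := h.finiteDimensional μ
    have := Submodule.finiteDimensional_of_le (hle μ)
    exact Module.Finite.equiv (Submodule.equivMapOfInjective _ N.injective_subtype _).symm
  · obtain ⟨K, hK⟩ := h.weight_eq_bot μ
    refine ⟨K, fun n hn => ?_⟩
    have := hle (μ + n)
    rw [hK n hn, le_bot_iff] at this
    exact Submodule.map_injective_of_injective N.injective_subtype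
      (this.trans (Submodule.map_bot _).symm)

/-- The direct sum of two modules. -/
def prodModes (Y : Modes V M) (Y' : Modes V M') : Modes V (M × M') where
  toFun a n := (Y a n).prodMap (Y' a n)
  map_add' a b := by
    funext n
    ext x <;> simp
  map_smul' c a := by
    funext n
    ext x <;> simp

theorem IsModule.prod {Y : Modes V M} {Y' : Modes V M'} (h : IsModule A Y) (h' : IsModule A Y') :
    IsModule A (prodModes Y Y') := by
  have htr : Truncated (prodModes Y Y') := fun a x => by
    obtain ⟨N, hN⟩ := h.truncated a x.1
    obtain ⟨N', hN'⟩ := h'.truncated a x.2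
    exact ⟨max N N', fun n hn => Prod.ext (hN n (le_trans (le_max_left _ _) hn))
      (hN' n (le_trans (le_max_right _ _) hn))⟩
  have hle : ∀ μ, weightSpace A (prodModes Y Y') μ ≤
      (weightSpace A Y μ).prod (weightSpace A Y' μ) := by
    intro μ u hu
    have := Module.End.mem_eigenspace_iff.mp hu
    exact ⟨Module.End.mem_eigenspace_iff.mpr (congrArg Prod.fst this),
      Module.End.mem_eigenspace_iff.mpr (congrArg Prod.snd this)⟩
  refine { Y_one := fun n => ?_, derivative := fun a n => ?_, truncated := htr, jacobi := ?_,
           independent := Module.End.eigenspaces_iSupIndep _, iSup_eq_top := ?_,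
           finiteDimensional := fun μ => ?_, weight_eq_bot := fun μ => ?_ }
  · refine LinearMap.ext fun x => ?_
    change (Y A.one n x.1, Y' A.one n x.2) = _
    rw [h.Y_one, h'.Y_one]
    split_ifs <;> rfl
  · refine LinearMap.ext fun x => ?_
    change (Y _ n x.1, Y' _ n x.2) = _
    rw [h.derivative, h'.derivative]
    rfl
  · rw [jacobi_iff_jacobiDefect]
    intro a b x l m α
    apply Prod.ext
    · have hfst : IsEquivariant (prodModes Y Y') Y (LinearMap.fst ℂ M M') := fun _ _ _ => rfl
      refine (hfst.map_jacobiDefect (A := A) htr a b x l m α).trans ?_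
      exact jacobi_iff_jacobiDefect.mp h.jacobi ..
    · have hsnd : IsEquivariant (prodModes Y Y') Y' (LinearMap.snd ℂ M M') := fun _ _ _ => rfl
      refine (hsnd.map_jacobiDefect (A := A) htr a b x l m α).trans ?_
      exact jacobi_iff_jacobiDefect.mp h'.jacobi ..
  · rw [eq_top_iff, ← Submodule.prod_top, ← h.iSup_eq_top, ← h'.iSup_eq_top,
      LinearMap.prod_eq_sup_map, Submodule.map_iSup, Submodule.map_iSup]
    refine sup_le (iSup_mono fun μ => ?_) (iSup_mono fun μ => ?_)
    · rintro _ ⟨u, hu, rfl⟩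
      refine Module.End.mem_eigenspace_iff.mpr (Prod.ext (Module.End.mem_eigenspace_iff.mp hu) ?_)
      change Y' A.ω 1 0 = μ • 0
      simp
    · rintro _ ⟨u, hu, rfl⟩
      refine Module.End.mem_eigenspace_iff.mpr (Prod.ext ?_ (Module.End.mem_eigenspace_iff.mp hu))
      change Y A.ω 1 0 = μ • 0
      simp
  · have := h.finiteDimensional μ
    have := h'.finiteDimensional μ
    have : FiniteDimensional ℂ ((weightSpace A Y μ).prod (weightSpace A Y' μ)) := by
      rw [LinearMap.prod_eq_sup_map]
      infer_instance
    exact Submodule.finiteDimensional_of_le (hle μ)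
  · obtain ⟨K, hK⟩ := h.weight_eq_bot μ
    obtain ⟨K', hK'⟩ := h'.weight_eq_bot μ
    refine ⟨min K K', fun n hn => ?_⟩
    have := hle (μ + n)
    rwa [hK n (hn.trans (min_le_left _ _)), hK' n (hn.trans (min_le_right _ _)),
      Submodule.prod_bot, le_bot_iff] at this

/-- The module homomorphisms from `M` to `M'` with values in the subspace `P`. -/
def equivariantMaps (Y : Modes V M) (Y' : Modes V M') (P : Submodule ℂ M') :
    Submodule ℂ (M →ₗ[ℂ] M') where
  carrier := {g | IsEquivariant Y Y' g ∧ ∀ u, g u ∈ P}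
  zero_mem' := ⟨fun a n x => by simp, fun u => zero_mem _⟩
  add_mem' h h' := ⟨fun a n x => by simp [h.1 a n x, h'.1 a n x],
    fun u => add_mem (h.2 u) (h'.2 u)⟩
  smul_mem' c g h := ⟨fun a n x => by simp [h.1 a n x], fun u => Submodule.smul_mem _ c (h.2 u)⟩

end Constructions

/-! ### Modules inside `G(W₁, W₂)` and their sum -/

section Delta

set_option maxSynthPendingDepth 5

variable {V : Type u} [AddCommGroup V] [Module ℂ V] {A : VertexOperatorAlgebra V}
  {W₁ W₂ : VModule.{u, v} A}

theorem isModuleInside_range {M : Type*} [AddCommGroup M] [Module ℂ M] {Y : Modes V M}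
    (hM : IsModule A Y) {g : M →ₗ[ℂ] truncatedSeries W₁.carrier W₂.carrier}
    (hg : IsEquivariant Y (action W₁ W₂) g) (hG : LinearMap.range g ≤ G W₁ W₂) :
    IsModuleInside W₁ W₂ (LinearMap.range g) := by
  refine ⟨hG, ?_, ?_⟩
  · rintro a n _ ⟨u, rfl⟩
    exact ⟨Y a n u, hg a n u⟩
  · exact hM.of_surjective (g := g.rangeRestrict) (fun a n u => Subtype.ext (hg a n u))
      g.surjective_rangeRestrict

theorem isModuleInside_bot : IsModuleInside W₁ W₂ ⊥ := by
  -- The zero subspace is the image of the zero map; `W₁` merely supplies some module as source.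
  have h : IsEquivariant W₁.Y (action W₁ W₂) 0 := fun a n x => by simp
  simpa using isModuleInside_range W₁.isModule h (by simp)

/-- The sum need not be direct, but it is the image of the external direct sum under addition. -/
theorem IsModuleInside.sup {N N' : Submodule ℂ (truncatedSeries W₁.carrier W₂.carrier)}
    (hN : IsModuleInside W₁ W₂ N) (hN' : IsModuleInside W₁ W₂ N') :
    IsModuleInside W₁ W₂ (N ⊔ N') := by
  obtain ⟨hle, hs, hm⟩ := hN
  obtain ⟨hle', hs', hm'⟩ := hN'
  have h : IsEquivariant (prodModes (restrict _ N hs) (restrict _ N' hs')) (action W₁ W₂)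
      (N.subtype.coprod N'.subtype) := by
    rintro a n ⟨x, y⟩
    simp [prodModes, restrict]
  have hr : LinearMap.range (N.subtype.coprod N'.subtype) = N ⊔ N' := by
    rw [LinearMap.range_coprod, Submodule.range_subtype, Submodule.range_subtype]
  rw [← hr]
  exact isModuleInside_range (hm.prod hm') h (hr ▸ sup_le hle hle')

theorem isModuleInside_finset_sup {ι : Type*} (s : Finset ι)
    {N : ι → Submodule ℂ (truncatedSeries W₁.carrier W₂.carrier)}
    (h : ∀ i ∈ s, IsModuleInside W₁ W₂ (N i)) : IsModuleInside W₁ W₂ (s.sup N) :=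
  Finset.sup_induction isModuleInside_bot (fun _ h₁ _ h₂ => h₁.sup h₂) h

/-- The module homomorphisms from `M` to `G(W₁, W₂)`. -/
noncomputable abbrev homG (W₁ W₂ M : VModule.{u, v} A) :
    Submodule ℂ (M.carrier →ₗ[ℂ] truncatedSeries W₁.carrier W₂.carrier) :=
  equivariantMaps M.Y (action W₁ W₂) (G W₁ W₂)

/-- Passing to the associated intertwining operator is linear and loses no information, so the
fusion rule bounds the dimension. -/
theorem finiteDimensional_homG (h : FiniteFusionRules.{u, v} A) (W₁ W₂ M : VModule.{u, v} A) :
    FiniteDimensional ℂ (homG W₁ W₂ M) := by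
  have := h M W₁ W₂
  let F : homG W₁ W₂ M →ₗ[ℂ] intertwiningOperators A M.Y W₁.Y W₂.Y
      M.isModule.toIsWeakModule W₁.isModule.toIsWeakModule W₂.isModule.toIsWeakModule :=
    { toFun := fun g => ⟨(truncatedSeries W₁.carrier W₂.carrier).subtype ∘ₗ g.1,
        isIntertwining_of_equivariant M.isModule.truncated W₁.isModule.truncated g.1 g.2.1 g.2.2⟩
      map_add' := fun g g' => rfl
      map_smul' := fun c g => rfl }
  refine FiniteDimensional.of_injective F fun g g' hgg => ?_
  apply Subtype.ext
  ext1 u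
  apply Subtype.ext
  exact LinearMap.congr_fun (congrArg Subtype.val hgg) u

/-- The image of a linear combination of homomorphisms lies in the sum of their images, so the
images of a finite spanning set suffice. -/
theorem exists_isModuleInside_range_le (h : FiniteFusionRules.{u, v} A)
    (W₁ W₂ M : VModule.{u, v} A) :
    ∃ N, IsModuleInside W₁ W₂ N ∧ ∀ g ∈ homG W₁ W₂ M, LinearMap.range g ≤ N := by
  have := finiteDimensional_homG h W₁ W₂ M
  obtain ⟨s, hs⟩ := (Submodule.fg_iff_finiteDimensional (homG W₁ W₂ M)).mpr this
  refine ⟨s.sup LinearMap.range, isModuleInside_finset_sup s fun g hgs => ?_, fun g hg => ?_⟩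
  · have hg : g ∈ homG W₁ W₂ M := hs ▸ Submodule.subset_span hgs
    exact isModuleInside_range M.isModule hg.1 (by rintro _ ⟨u, rfl⟩; exact hg.2 u)
  · rw [← hs] at hg
    rintro _ ⟨u, rfl⟩
    induction hg using Submodule.span_induction with
    | mem g hgs => exact Finset.le_sup (f := LinearMap.range) hgs (LinearMap.mem_range_self g u)
    | zero => exact zero_mem _
    | add g g' _ _ ih ih' => exact add_mem ih ih'
    | smul c g _ ih => exact Submodule.smul_mem _ c ih

theorem isModuleInside_le_of_irreducibles
    (h_cr : ∀ M : VModule.{u, v} A, IsCompletelyReducible M.Y) {S : Set (VModule.{u, v} A)}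
    (hS : ∀ M : VModule.{u, v} A, IsIrreducible M.Y → ∃ N ∈ S, Equivalent M.Y N.Y)
    {D : Submodule ℂ (truncatedSeries W₁.carrier W₂.carrier)}
    (hD : ∀ M ∈ S, ∀ g ∈ homG W₁ W₂ M, LinearMap.range g ≤ D)
    {N : Submodule ℂ (truncatedSeries W₁.carrier W₂.carrier)} (hN : IsModuleInside W₁ W₂ N) :
    N ≤ D := by
  obtain ⟨hle, hs, hm⟩ := hN
  obtain ⟨T, hT, -, hTtop⟩ : IsCompletelyReducible (restrict (action W₁ W₂) N hs) :=
    h_cr ⟨N, restrict _ N hs, hm⟩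
  rw [← Submodule.map_subtype_top N, ← hTtop, Submodule.map_le_iff_le_comap, sSup_le_iff]
  intro P hP
  obtain ⟨hPs, hPirr⟩ := hT P hP
  obtain ⟨M, hMS, f, hf⟩ := hS ⟨P, restrict (restrict _ N hs) P hPs, hm.restrict P hPs⟩ hPirr
  -- The inclusion of the irreducible summand `P`, transported along `M ≅ P`, is a homomorphism from
  -- a representative into `G(W₁, W₂)` with image `P`.
  have hmem : N.subtype ∘ₗ P.subtype ∘ₗ f.symm.toLinearMap ∈ homG W₁ W₂ M := by
    refine ⟨fun a n x => ?_, fun u => hle (Subtype.property _)⟩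
    have : f.symm (M.Y a n x) = restrict (restrict _ N hs) P hPs a n (f.symm x) := by
      rw [LinearEquiv.symm_apply_eq]
      refine Eq.trans ?_ (hf a n (f.symm x)).symm
      rw [LinearEquiv.apply_symm_apply]
    exact congrArg (fun p : P => ((p : N) : truncatedSeries W₁.carrier W₂.carrier)) this
  intro x hx
  refine hD M hMS _ hmem ⟨f ⟨x, hx⟩, ?_⟩
  exact congrArg (fun p : P => ((p : N) : truncatedSeries W₁.carrier W₂.carrier))
    (f.symm_apply_apply ⟨x, hx⟩)

theorem isModuleInside_Delta (h_irr : FinitelyManyIrreducibles.{u, v} A)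
    (h_cr : ∀ M : VModule.{u, v} A, IsCompletelyReducible M.Y)
    (h_fusion : FiniteFusionRules.{u, v} A) (W₁ W₂ : VModule.{u, v} A) :
    IsModuleInside W₁ W₂ (Delta W₁ W₂) := by
  obtain ⟨S, hfin, hS⟩ := h_irr
  choose D hDin hD using exists_isModuleInside_range_le h_fusion W₁ W₂
  have hsup := isModuleInside_finset_sup hfin.toFinset fun M _ => hDin M
  -- The finite sum is itself one of the modules being summed in `Delta W₁ W₂`, and it contains all
  -- the others.
  have heq : Delta W₁ W₂ = hfin.toFinset.sup D := by
    refine le_antisymm (sSup_le fun N hN => ?_) (le_sSup hsup)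
    refine isModuleInside_le_of_irreducibles h_cr hS (fun M hM g hg => ?_) hN
    exact (hD M g hg).trans (Finset.le_sup (hfin.mem_toFinset.mpr hM))
  rw [heq]
  exact hsup

end Delta

end VOA

theorem proposition4p9 {V : Type u} [AddCommGroup V] [Module ℂ V]
    (A : VOA.VertexOperatorAlgebra V)
    (h_irr : VOA.FinitelyManyIrreducibles.{u, v} A)
    (h_cr : ∀ M : VOA.VModule.{u, v} A, VOA.IsCompletelyReducible M.Y)
    (h_fusion : VOA.FiniteFusionRules.{u, v} A)
    (W₁ W₂ : VOA.VModule.{u, v} A) :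
    VOA.IsModuleInside W₁ W₂ (VOA.Delta W₁ W₂) ∧
      (∀ N, VOA.IsModuleInside W₁ W₂ N → N ≤ VOA.Delta W₁ W₂) ∧
      (∀ N, Maximal (VOA.IsModuleInside W₁ W₂) N ↔ N = VOA.Delta W₁ W₂) := by
  have hDelta := VOA.isModuleInside_Delta h_irr h_cr h_fusion W₁ W₂
  have hle : ∀ N, VOA.IsModuleInside W₁ W₂ N → N ≤ VOA.Delta W₁ W₂ := fun N hN => le_sSup hN
  refine ⟨hDelta, hle, fun N => ⟨fun hN => hN.eq_of_le hDelta (hle N hN.prop), ?_⟩⟩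
  rintro rfl
  exact ⟨hDelta, fun N hN _ => hle N hN⟩
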